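/- Let $\omega=e^{2\pi i/3}$, let $\Omega=\{1,\omega,\omega^2\}$ and let $\mathbb S^1\subset\mathbb C$ be the unit circle. Put $I_0=\{e^{i\theta}\mid 0<\theta<2\pi/3\}$, $I_1=\omega I_0$, $I_2=\omega^2I_0$, and write $\alpha\sim\beta$ when $\alpha,\beta\in\mathbb S^1\setminus\Omega$ lie in a same arc $I_j$. For $\alpha_1,\alpha_2\in\mathbb S^1\setminus\Omega$ define $\tau_{\alpha_1,\alpha_2}:\mathbb R\to\mathbb C$ by $$\tau_{\alpha_1,\alpha_2}(t)=\alpha_1\alpha_2+\alpha_1^{-2}\alpha_2+\alpha_1\alpha_2^{-2}+(\alpha_1^{-2}-\alpha_1)(\alpha_2^{-2}-\alpha_2)\,t .$$ Goldman's deltoid is the curve $\{z\in\mathbb C\mid |z|^4-8\operatorname{Re}(z^3)+18|z|^2-27=0\}$. Proposition. Let $\alpha_1,\alpha_2,\beta_1,\beta_2\in\mathbb S^1\setminus\Omega$ satisfy $\alpha_1\alpha_2=\beta_1\beta_2$. Then $\tau_{\alpha_1,\alpha_2}(\mathbb R)$ and $\tau_{\beta_1,\beta_2}(\mathbb R)$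 are the same real affine line $\ell$, and $\ell$ is tangent to Goldman's deltoid at the point $\tau_{\alpha_1,\alpha_2}(1)=\tau_{\beta_1,\beta_2}(1)$ (at a cusp of the deltoid this means that $\ell$ is the tangent line of the cusp). Moreover, $\tau_{\alpha_1,\alpha_2}$ and $\tau_{\beta_1,\beta_2}$ parametrize $\ell$ in the same direction (that is, they differ by an increasing bijective change of parameter $\mathbb R\to\mathbb R$) if and only if there exists $\delta\in\Omega$ such that $\delta\alpha_1\sim\beta_1$ and $\delta^{-1}\alpha_2\sim\beta_2$. -/

import Mathlib

namespace GoldmanDeltoid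

/-- The primitive cube root of unity `ω = exp (2πi/3)`. -/
noncomputable def omega : ℂ := Complex.exp (2 * Real.pi * Complex.I / 3)

/-- The set `Ω = {1, ω, ω²}` of cube roots of unity. -/
def Omega : Set ℂ := {1, omega, omega ^ 2}

/-- Parameters are the unit complex numbers that are not cube roots of unity. -/
def Parameter : Set ℂ := Metric.sphere (0 : ℂ) 1 \ Omega

/-- The open arc `I_0 = {exp (iθ) | 0 < θ < 2π/3}` of the unit circle. -/
def arcZero : Set ℂ :=
  {z | ∃ θ : ℝ, 0 < θ ∧ θ < 2 * Real.pi / 3 ∧ z = Complex.exp (θ * Complex.I)}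

/-- The open arc `I_j = ω ^ j I_0`, for `j = 0, 1, 2`. -/
def arc (j : Fin 3) : Set ℂ := (fun z => omega ^ (j : ℕ) * z) '' arcZero

/-- The relation `α ∼ β`: both numbers lie in a same arc among `I_0, I_1, I_2`. -/
def SameComponent (α β : ℂ) : Prop := ∃ j : Fin 3, α ∈ arc j ∧ β ∈ arc j

/-- The parametrization
`τ(t) = α₁α₂ + α₁⁻²α₂ + α₁α₂⁻² + (α₁⁻² - α₁)(α₂⁻² - α₂) t`. -/
noncomputable def tau (α₁ α₂ : ℂ) (t : ℝ) : ℂ :=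
  α₁ * α₂ + (α₁ ^ 2)⁻¹ * α₂ + α₁ * (α₂ ^ 2)⁻¹
    + ((α₁ ^ 2)⁻¹ - α₁) * ((α₂ ^ 2)⁻¹ - α₂) * (t : ℂ)

/-- Goldman's polynomial `f(z) = |z|⁴ - 8 Re(z³) + 18 |z|² - 27`. -/
noncomputable def goldmanPoly (z : ℂ) : ℝ :=
  ‖z‖ ^ 4 - 8 * (z ^ 3).re + 18 * ‖z‖ ^ 2 - 27

/-- Goldman's deltoid, the zero set of Goldman's polynomial. -/
def deltoid : Set ℂ := {z | goldmanPoly z = 0}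

/-- `ℓ` is a (real affine) line through the point `z` of `S`, and the direction of `ℓ` is exactly
the set of tangent vectors to `S` at `z`. The cone `tangentConeAt ℝ S z` is symmetric (the real
scaling factors in it may be negative), so at a cusp of a curve it is the full tangent line. -/
def IsTangentLineAt (ℓ S : Set ℂ) (z : ℂ) : Prop :=
  z ∈ S ∧ ∃ v : ℂ, v ≠ 0 ∧ ℓ = Set.range (fun t : ℝ => z + t • v) ∧
    tangentConeAt ℝ S z = Set.range (fun t : ℝ => t • v)

/-- Two parametrizations run in the same direction: each is obtained from the other by an
increasing change of the parameter. -/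
def SameDirection (γ₁ γ₂ : ℝ → ℂ) : Prop := ∃ φ : ℝ ≃o ℝ, ∀ t : ℝ, γ₁ t = γ₂ (φ t)

end GoldmanDeltoid

/-! Put γ = α₁α₂. Expanding gives τ(1) = 2γ + γ⁻², the standard parametrization of the deltoid, and
the velocity v of τ satisfies v̄ = γv. If u⁻² = γ then ū = γu as well, so v is a nonzero real
multiple of u (`exists_velocity_eq_real_mul`). Point and line thus depend on γ alone.

Tangency is a tangent cone computation in the frame (u, iu), uniform in smooth points and cusps: a
Taylor expansion bounds the cone from above (`tangentConeAt_deltoid_subset`) and explicit chords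
fill it (`exists_rescaled_chord_tendsto`).

For directions, write α = ωʲe^{iθ} with 0 < θ < 2π/3. Then α⁻² - α = -2i ωʲ sin(3θ/2) e^{-iθ/2} with
a positive sine, so the direction of v is read off from arc indices and angles. Comparing it with
the equal products gives `exists_pos_mul_velocity_iff`. -/

open Filter Topology

namespace GoldmanDeltoid

/-! ### Goldman's polynomial near a point of the deltoid -/

/-- The point `2γ + γ⁻²` of the deltoid, where `γ = u⁻²`. -/
noncomputable def deltoidPoint (u : ℂ) : ℂ := 2 * (u ^ 2)⁻¹ + u ^ 4

lemma inv_eq_conj_of_norm_eq_one {u : ℂ} (hu : ‖u‖ = 1) : u⁻¹ = (starRingEnd ℂ) u := by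
  rw [Complex.inv_def, Complex.normSq_eq_norm_sq, hu]; simp

lemma cube_re_sq_add_im_sq {u : ℂ} (hu : ‖u‖ = 1) : (u ^ 3).re ^ 2 + (u ^ 3).im ^ 2 = 1 := by
  have h := Complex.sq_norm (u ^ 3)
  rw [norm_pow, hu, Complex.normSq_apply] at h
  linarith

lemma deltoidPoint_eq {u : ℂ} (hu : ‖u‖ = 1) :
    deltoidPoint u = u * ((3 * (u ^ 3).re : ℝ) - (u ^ 3).im * Complex.I) := by
  have hu0 : u ≠ 0 := by rintro rfl; simp at hu
  have h3 : (starRingEnd ℂ) (u ^ 3) = (u ^ 3)⁻¹ := by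
    rw [inv_eq_conj_of_norm_eq_one (by simp [hu])]
  have h4 : ((3 * (u ^ 3).re : ℝ) - (u ^ 3).im * Complex.I : ℂ)
      = 2 * (starRingEnd ℂ) (u ^ 3) + u ^ 3 := by
    apply Complex.ext
    · simp only [Complex.sub_re, Complex.ofReal_re, Complex.mul_re, Complex.ofReal_im,
        Complex.I_re, Complex.I_im, Complex.add_re, Complex.conj_re, Complex.re_ofNat,
        Complex.im_ofNat, Complex.conj_im]
      ring
    · simp only [Complex.sub_im, Complex.ofReal_re, Complex.mul_im, Complex.ofReal_im,
        Complex.I_re, Complex.I_im, Complex.add_im, Complex.conj_re, Complex.re_ofNat,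
        Complex.im_ofNat, Complex.conj_im]
      ring
  rw [h4, h3, deltoidPoint]
  field_simp

/-- The Taylor expansion of Goldman's polynomial at a point of the deltoid, in coordinates adapted
to the tangent line. -/
lemma goldmanPoly_deltoidPoint_add {u : ℂ} (hu : ‖u‖ = 1) (a b : ℝ) :
    goldmanPoly (deltoidPoint u + u * (a + b * Complex.I)) =
      -64 * (u ^ 3).im ^ 3 * b - 4 * (u ^ 3).im ^ 2 * a ^ 2
        + 72 * (u ^ 3).re * (u ^ 3).im * a * b + (108 - 60 * (u ^ 3).im ^ 2) * b ^ 2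
        + 4 * (u ^ 3).re * a ^ 3 + 20 * (u ^ 3).im * a ^ 2 * b + 36 * (u ^ 3).re * a * b ^ 2
        - 12 * (u ^ 3).im * b ^ 3 + (a ^ 2 + b ^ 2) ^ 2 := by
  have hcs := cube_re_sq_add_im_sq hu
  rw [deltoidPoint_eq hu]
  set c := (u ^ 3).re with hc
  set s := (u ^ 3).im with hs
  have hu3 : u ^ 3 = c + s * Complex.I := (Complex.re_add_im _).symm
  -- The point divided by u; the polynomial then needs only |ζ| and Re((c + is)ζ³).
  set ζ : ℂ := ⟨3 * c + a, b - s⟩ with hζ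
  have h1 : u * ((3 * c : ℝ) - s * Complex.I) + u * (a + b * Complex.I) = u * ζ := by
    have : ζ = (3 * c : ℝ) - s * Complex.I + (a + b * Complex.I) := by
      apply Complex.ext <;> simp [hζ]; ring
    rw [this]; ring
  have hn : ‖u * ζ‖ ^ 2 = (3 * c + a) ^ 2 + (b - s) ^ 2 := by
    rw [norm_mul, hu, one_mul, Complex.sq_norm, Complex.normSq_apply]; ring
  have hn4 : ‖u * ζ‖ ^ 4 = ((3 * c + a) ^ 2 + (b - s) ^ 2) ^ 2 := by rw [← hn]; ring
  have hr : ((u * ζ) ^ 3).re = c * ((3 * c + a) ^ 3 - 3 * (3 * c + a) * (b - s) ^ 2)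
      - s * (3 * (3 * c + a) ^ 2 * (b - s) - (b - s) ^ 3) := by
    rw [mul_pow, hu3]
    simp [hζ, pow_succ]
    ring
  rw [h1, goldmanPoly, hn, hn4, hr]
  have hc2 : c ^ 2 = 1 - s ^ 2 := by linarith
  have hc3 : c ^ 3 = c * (1 - s ^ 2) := by rw [← hc2]; ring
  have hc4 : c ^ 4 = (1 - s ^ 2) ^ 2 := by rw [← hc2]; ring
  ring_nf
  rw [hc4, hc3, hc2]
  ring

lemma deltoidPoint_mem {u : ℂ} (hu : ‖u‖ = 1) : deltoidPoint u ∈ deltoid := by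
  have h := goldmanPoly_deltoidPoint_add hu 0 0
  simpa [deltoid] using h

lemma exists_inv_sq_eq {γ : ℂ} (hγ : ‖γ‖ = 1) : ∃ u : ℂ, ‖u‖ = 1 ∧ (u ^ 2)⁻¹ = γ := by
  obtain ⟨u, hu⟩ := IsAlgClosed.exists_pow_nat_eq γ⁻¹ (n := 2) (by norm_num)
  refine ⟨u, ?_, by rw [hu, inv_inv]⟩
  have h : ‖u‖ ^ 2 = 1 := by rw [← norm_pow, hu, norm_inv, hγ, inv_one]
  exact (pow_eq_one_iff_of_nonneg (norm_nonneg u) two_ne_zero).1 h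

lemma two_mul_add_inv_sq_mem_deltoid {γ : ℂ} (hγ : ‖γ‖ = 1) : 2 * γ + (γ ^ 2)⁻¹ ∈ deltoid := by
  obtain ⟨u, hu, rfl⟩ := exists_inv_sq_eq hγ
  have h := deltoidPoint_mem hu
  rw [deltoidPoint] at h
  convert h using 2
  rw [inv_pow, inv_inv]; ring

/-! ### The tangent cone of the deltoid -/

/-- The lowest-order terms of the Taylor expansion force the iu-component B of a tangent vector to
vanish: -64s³b when s = Im u³ ≠ 0, and 108b² at a cusp, where s = 0. -/
lemma tangentConeAt_deltoid_subset {u : ℂ} (hu : ‖u‖ = 1) :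
    tangentConeAt ℝ deltoid (deltoidPoint u) ⊆ Set.range (fun t : ℝ => t • u) := by
  intro y hy
  obtain ⟨k, d, hd, hds, hkd⟩ := mem_tangentConeAt_iff_exists_seq.1 hy
  have hu0 : u ≠ 0 := by rintro rfl; simp at hu
  have hcs := cube_re_sq_add_im_sq hu
  set a : ℕ → ℝ := fun n => (u⁻¹ * d n).re
  set b : ℕ → ℝ := fun n => (u⁻¹ * d n).im
  have hud : Tendsto (fun n => u⁻¹ * d n) atTop (𝓝 0) := by simpa using hd.const_mul u⁻¹
  have ha : Tendsto a atTop (𝓝 0) := (Complex.continuous_re.tendsto 0).comp hud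
  have hb : Tendsto b atTop (𝓝 0) := (Complex.continuous_im.tendsto 0).comp hud
  have hukd : Tendsto (fun n => u⁻¹ * (k n • d n)) atTop (𝓝 (u⁻¹ * y)) := hkd.const_mul u⁻¹
  have hA : Tendsto (fun n => k n * a n) atTop (𝓝 (u⁻¹ * y).re) := by
    refine ((Complex.continuous_re.tendsto _).comp hukd).congr fun n => ?_
    simp only [Function.comp, mul_smul_comm, Complex.smul_re, smul_eq_mul, a]
  have hB : Tendsto (fun n => k n * b n) atTop (𝓝 (u⁻¹ * y).im) := by
    refine ((Complex.continuous_im.tendsto _).comp hukd).congr fun n => ?_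
    simp only [Function.comp, mul_smul_comm, Complex.smul_im, smul_eq_mul, b]
  have hzero : ∀ᶠ n in atTop, goldmanPoly (deltoidPoint u + u * (a n + b n * Complex.I)) = 0 := by
    filter_upwards [hds] with n hn
    rw [Complex.re_add_im, mul_inv_cancel_left₀ hu0]
    exact hn
  simp only [goldmanPoly_deltoidPoint_add hu] at hzero
  set c := (u ^ 3).re
  set s := (u ^ 3).im
  set A := (u⁻¹ * y).re with hAdef
  set B := (u⁻¹ * y).im with hBdef
  suffices hB0 : B = 0 by
    refine ⟨A, ?_⟩
    have : u⁻¹ * y = A := by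
      rw [← Complex.re_add_im (u⁻¹ * y), ← hAdef, ← hBdef, hB0]; simp
    simp only [Complex.real_smul]
    rw [← this]; field_simp
  by_cases hs : s = 0
  -- Cusp: the expansion is multiplied by k². Each term other than 108(kb)² keeps a spare factor a
  -- or b tending to 0.
  · have hlim : Tendsto (fun n => 108 * (k n * b n) ^ 2 + 4 * c * (k n * a n) ^ 2 * a n
        + 36 * c * (k n * b n) ^ 2 * a n
        + ((k n * a n) * a n + (k n * b n) * b n) ^ 2) atTop
        (𝓝 (108 * B ^ 2 + 4 * c * A ^ 2 * 0 + 36 * c * B ^ 2 * 0 + (A * 0 + B * 0) ^ 2)) :=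
      ((((hB.pow 2).const_mul _).add (((hA.pow 2).const_mul _).mul ha)).add
        (((hB.pow 2).const_mul _).mul ha)).add (((hA.mul ha).add (hB.mul hb)).pow 2)
    have h0 := tendsto_nhds_unique (hlim.congr' (f₂ := fun _ => (0 : ℝ)) ?_) tendsto_const_nhds
    · have : B ^ 2 = 0 := by linarith
      exact pow_eq_zero_iff (two_ne_zero) |>.1 this
    · filter_upwards [hzero] with n hn
      rw [hs] at hn
      linear_combination (k n) ^ 2 * hn
  -- Smooth point: one factor k suffices, and only the linear term survives.
  · have hlim : Tendsto (fun n => -64 * s ^ 3 * (k n * b n) - 4 * s ^ 2 * (k n * a n) * a n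
        + 72 * c * s * (k n * a n) * b n + (108 - 60 * s ^ 2) * (k n * b n) * b n
        + 4 * c * (k n * a n) * a n ^ 2 + 20 * s * (k n * a n) * (a n * b n)
        + 36 * c * (k n * a n) * b n ^ 2
        - 12 * s * (k n * b n) * b n ^ 2
        + ((k n * a n) * a n + (k n * b n) * b n) * (a n ^ 2 + b n ^ 2)) atTop
        (𝓝 (-64 * s ^ 3 * B - 4 * s ^ 2 * A * 0 + 72 * c * s * A * 0 + (108 - 60 * s ^ 2) * B * 0
          + 4 * c * A * 0 ^ 2 + 20 * s * A * (0 * 0) + 36 * c * A * 0 ^ 2 - 12 * s * B * 0 ^ 2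
          + (A * 0 + B * 0) * (0 ^ 2 + 0 ^ 2))) :=
      ((((((((hB.const_mul _).sub ((hA.const_mul _).mul ha)).add ((hA.const_mul _).mul hb)).add
        ((hB.const_mul _).mul hb)).add ((hA.const_mul _).mul (ha.pow 2))).add
        ((hA.const_mul _).mul (ha.mul hb))).add ((hA.const_mul _).mul (hb.pow 2))).sub
        ((hB.const_mul _).mul (hb.pow 2))).add
        (((hA.mul ha).add (hB.mul hb)).mul ((ha.pow 2).add (hb.pow 2)))
    have h0 := tendsto_nhds_unique (hlim.congr' (f₂ := fun _ => (0 : ℝ)) ?_) tendsto_const_nhds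
    · have h1 : s ^ 3 * B = 0 := by linarith
      exact (mul_eq_zero.1 h1).resolve_left (pow_ne_zero 3 hs)
    · filter_upwards [hzero] with n hn
      linear_combination k n * hn

/-- The difference between the deltoid points of parameters `γ (1 + ix) / (1 - ix)` and `γ`, where
`γ = u⁻²`. -/
noncomputable def deltoidChord (u : ℂ) (x : ℝ) : ℂ :=
  4 * Complex.I * x *
    ((u ^ 2)⁻¹ / (1 - x * Complex.I) - u ^ 4 / (1 + x * Complex.I) ^ 2)

lemma one_add_mul_I_ne_zero (x : ℝ) : (1 + x * Complex.I : ℂ) ≠ 0 := fun h => by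
  simpa using congrArg Complex.re h

lemma one_sub_mul_I_ne_zero (x : ℝ) : (1 - x * Complex.I : ℂ) ≠ 0 := fun h => by
  simpa using congrArg Complex.re h

/-- The Cayley factor (1 + ix)/(1 - ix) has norm 1, so the endpoint of the chord is again of the
form 2γ + γ⁻². -/
lemma deltoidPoint_add_deltoidChord_mem {u : ℂ} (hu : ‖u‖ = 1) (x : ℝ) :
    deltoidPoint u + deltoidChord u x ∈ deltoid := by
  have hu0 : u ≠ 0 := by rintro rfl; simp at hu
  have h1 := one_add_mul_I_ne_zero x
  have h2 := one_sub_mul_I_ne_zero x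
  have hconj : (starRingEnd ℂ) (1 + x * Complex.I) = 1 - x * Complex.I := by
    simp [sub_eq_add_neg]
  have hw : ‖(u ^ 2)⁻¹ * ((1 + x * Complex.I) / (1 - x * Complex.I))‖ = 1 := by
    rw [norm_mul, norm_inv, norm_pow, hu, norm_div, ← hconj, Complex.norm_conj,
      div_self (norm_ne_zero_iff.2 h1)]
    simp
  convert two_mul_add_inv_sq_mem_deltoid hw using 1
  have hI : 4 * Complex.I * x = 4 * (x * Complex.I) := by ring
  rw [deltoidPoint, deltoidChord, hI]
  generalize (x * Complex.I : ℂ) = y at h1 h2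
  field_simp
  ring

lemma tendsto_deltoidChord (u : ℂ) : Tendsto (deltoidChord u) (𝓝[≠] 0) (𝓝 0) := by
  have : ContinuousAt (deltoidChord u) 0 := by
    unfold deltoidChord
    refine ContinuousAt.mul (by fun_prop) (ContinuousAt.sub ?_ ?_)
    · exact ContinuousAt.div (by fun_prop) (by fun_prop) (one_sub_mul_I_ne_zero 0)
    · exact ContinuousAt.div (by fun_prop) (by fun_prop) (pow_ne_zero 2 (one_add_mul_I_ne_zero 0))
  have h := this.tendsto.mono_left (nhdsWithin_le_nhds (s := {0}ᶜ))
  simpa [deltoidChord] using h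

/-- A real multiple of `u` is the limit of rescaled chords: the first order is enough at a smooth
point, the second order at a cusp. -/
lemma exists_rescaled_chord_tendsto {u : ℂ} (hu : ‖u‖ = 1) :
    ∃ (k : ℝ → ℝ) (r : ℝ), r ≠ 0 ∧
      Tendsto (fun x => k x • deltoidChord u x) (𝓝[≠] 0) (𝓝 (r • u)) := by
  have hu0 : u ≠ 0 := by rintro rfl; simp at hu
  have hcs := cube_re_sq_add_im_sq hu
  set c := (u ^ 3).re with hc
  set s := (u ^ 3).im with hs
  have hu3 : u ^ 3 = c + s * Complex.I := (Complex.re_add_im _).symm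
  have hu3i : (u ^ 3)⁻¹ = c - s * Complex.I := by
    rw [inv_eq_conj_of_norm_eq_one (by simp [hu]), hu3]
    simp [sub_eq_add_neg]
  by_cases h0 : s = 0
  -- At a cusp u⁻² = u⁴ = cu, so the first-order term of the chord cancels and -12c x² u leads.
  · refine ⟨fun x => (x ^ 2)⁻¹, -12 * c, ?_, ?_⟩
    · intro h
      have : c = 0 := by linarith
      rw [this, h0] at hcs
      norm_num at hcs
    have hu2 : (u ^ 2)⁻¹ = c * u := by
      have : (u ^ 2)⁻¹ = (u ^ 3)⁻¹ * u := by field_simp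
      rw [this, hu3i, h0]; simp
    have hu4 : u ^ 4 = c * u := by
      rw [pow_succ, hu3, h0]; simp
    have hcont : ContinuousAt (fun x : ℝ => 4 * Complex.I * (c * u) *
        ((3 * Complex.I - x) / ((1 - x * Complex.I) * (1 + x * Complex.I) ^ 2))) 0 := by
      refine ContinuousAt.mul (by fun_prop) (ContinuousAt.div (by fun_prop) (by fun_prop) ?_)
      exact mul_ne_zero (one_sub_mul_I_ne_zero 0) (pow_ne_zero 2 (one_add_mul_I_ne_zero 0))
    have hlim := hcont.tendsto.mono_left (nhdsWithin_le_nhds (s := {0}ᶜ))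
    have hval : 4 * Complex.I * (c * u) * ((3 * Complex.I - (0 : ℝ)) /
        ((1 - (0 : ℝ) * Complex.I) * (1 + (0 : ℝ) * Complex.I) ^ 2)) = (-12 * c) • u := by
      simp only [Complex.real_smul]
      push_cast
      simp only [zero_mul, sub_zero, add_zero, one_pow, mul_one, div_one]
      linear_combination 12 * c * u * Complex.I_sq
    rw [hval] at hlim
    refine hlim.congr' ?_
    filter_upwards [self_mem_nhdsWithin] with x hx
    have hx0 : (x : ℂ) ≠ 0 := by exact_mod_cast hx
    have h1 := one_add_mul_I_ne_zero x
    have h2 := one_sub_mul_I_ne_zero x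
    have hdiff : c * u / (1 - x * Complex.I) - c * u / (1 + x * Complex.I) ^ 2
        = c * u * (x * (3 * Complex.I - x)) / ((1 - x * Complex.I) * (1 + x * Complex.I) ^ 2) := by
      have hx3 : x * (3 * Complex.I - x) = x * Complex.I * (3 + x * Complex.I) := by
        linear_combination -(x : ℂ) ^ 2 * Complex.I_sq
      rw [hx3]
      generalize (x * Complex.I : ℂ) = y at h1 h2
      field_simp
      ring
    rw [deltoidChord, hu2, hu4, hdiff, Complex.real_smul]
    push_cast
    generalize (1 - x * Complex.I : ℂ) = p at h2
    generalize (1 + x * Complex.I : ℂ) = q at h1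
    field_simp
  · refine ⟨fun x => x⁻¹, 8 * s, by simpa using h0, ?_⟩
    have hcont : ContinuousAt (fun x : ℝ => 4 * Complex.I *
        ((u ^ 2)⁻¹ / (1 - x * Complex.I) - u ^ 4 / (1 + x * Complex.I) ^ 2)) 0 := by
      refine ContinuousAt.mul (by fun_prop) (ContinuousAt.sub ?_ ?_)
      · exact ContinuousAt.div (by fun_prop) (by fun_prop) (one_sub_mul_I_ne_zero 0)
      · exact ContinuousAt.div (by fun_prop) (by fun_prop)
          (pow_ne_zero 2 (one_add_mul_I_ne_zero 0))
    have hlim := hcont.tendsto.mono_left (nhdsWithin_le_nhds (s := {0}ᶜ))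
    have hval : 4 * Complex.I * ((u ^ 2)⁻¹ / (1 - (0 : ℝ) * Complex.I)
        - u ^ 4 / (1 + (0 : ℝ) * Complex.I) ^ 2) = (8 * s) • u := by
      have e1 : (u ^ 2)⁻¹ = (u ^ 3)⁻¹ * u := by field_simp
      have e2 : u ^ 4 = u ^ 3 * u := by ring
      rw [e1, e2, hu3i, hu3, Complex.real_smul]
      push_cast
      simp only [zero_mul, sub_zero, add_zero, one_pow, div_one]
      linear_combination (-8 * s * u) * Complex.I_sq
    rw [hval] at hlim
    refine hlim.congr' ?_
    filter_upwards [self_mem_nhdsWithin] with x hx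
    have hx0 : (x : ℂ) ≠ 0 := by exact_mod_cast hx
    rw [deltoidChord, Complex.real_smul]
    push_cast
    field_simp

lemma tangentConeAt_deltoid {u : ℂ} (hu : ‖u‖ = 1) :
    tangentConeAt ℝ deltoid (deltoidPoint u) = Set.range (fun t : ℝ => t • u) := by
  refine (tangentConeAt_deltoid_subset hu).antisymm ?_
  rintro _ ⟨t, rfl⟩
  obtain ⟨k, r, hr, hlim⟩ := exists_rescaled_chord_tendsto hu
  refine mem_tangentConeAt_of_seq (𝓝[≠] (0 : ℝ)) (fun x => (t / r) * k x) (deltoidChord u)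
    (tendsto_deltoidChord u)
    (Eventually.of_forall (deltoidPoint_add_deltoidChord_mem hu)) ?_
  have h := hlim.const_smul (t / r)
  rw [smul_smul, div_mul_cancel₀ _ hr] at h
  simpa only [smul_smul] using h

/-! ### Cube roots of unity, arcs and the lines -/

/-- The velocity of the parametrization `tau α₁ α₂`. -/
noncomputable def velocity (α₁ α₂ : ℂ) : ℂ := ((α₁ ^ 2)⁻¹ - α₁) * ((α₂ ^ 2)⁻¹ - α₂)

lemma tau_eq {α₁ α₂ : ℂ} (h₁ : ‖α₁‖ = 1) (h₂ : ‖α₂‖ = 1) (t : ℝ) :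
    tau α₁ α₂ t = 2 * (α₁ * α₂) + ((α₁ * α₂) ^ 2)⁻¹ + (t - 1 : ℝ) * velocity α₁ α₂ := by
  have h₁0 : α₁ ≠ 0 := by rintro rfl; simp at h₁
  have h₂0 : α₂ ≠ 0 := by rintro rfl; simp at h₂
  rw [tau, velocity, mul_pow, mul_inv]
  push_cast
  field_simp
  ring

lemma omega_pow_three : omega ^ 3 = 1 := by
  have h := (Complex.isPrimitiveRoot_exp 3 (by norm_num)).pow_eq_one
  simpa [omega] using h

lemma inv_sq_eq_self_of_pow_three_eq_one {δ : ℂ} (hδ : δ ^ 3 = 1) : (δ ^ 2)⁻¹ = δ :=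
  inv_eq_of_mul_eq_one_right (by rw [← pow_succ, hδ])

lemma omega_ne_zero : omega ≠ 0 := Complex.exp_ne_zero _

lemma norm_omega : ‖omega‖ = 1 := by
  have h : ‖omega‖ ^ 3 = 1 := by rw [← norm_pow, omega_pow_three, norm_one]
  exact (pow_eq_one_iff_of_nonneg (norm_nonneg _) three_ne_zero).1 h

lemma omega_pow_mem_Omega (n : ℕ) : omega ^ n ∈ Omega := by
  rw [← Nat.mod_add_div n 3, pow_add, pow_mul, omega_pow_three, one_pow, mul_one]
  have h : n % 3 < 3 := Nat.mod_lt _ (by norm_num)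
  interval_cases n % 3 <;> simp [Omega]

lemma pow_three_of_mem_Omega {δ : ℂ} (hδ : δ ∈ Omega) : δ ^ 3 = 1 := by
  rcases hδ with rfl | rfl | rfl
  · simp
  · exact omega_pow_three
  · rw [← pow_mul, mul_comm, pow_mul, omega_pow_three, one_pow]

lemma norm_eq_one_of_mem_Parameter {α : ℂ} (hα : α ∈ Parameter) : ‖α‖ = 1 := by
  simpa using hα.1

lemma exists_mem_arc {α : ℂ} (hα : α ∈ Parameter) : ∃ j : Fin 3, α ∈ arc j := by
  have hn := norm_eq_one_of_mem_Parameter hα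
  have hπ := Real.pi_pos
  obtain ⟨θ, h0, h2, hθ⟩ : ∃ θ : ℝ, 0 ≤ θ ∧ θ < 2 * Real.pi ∧ α = Complex.exp (θ * Complex.I) := by
    have h := Complex.norm_mul_exp_arg_mul_I α
    rw [hn, Complex.ofReal_one, one_mul] at h
    have hle := Complex.arg_le_pi α
    have hlt := Complex.neg_pi_lt_arg α
    rcases le_or_gt 0 α.arg with h' | h'
    · exact ⟨α.arg, h', by linarith, h.symm⟩
    · refine ⟨α.arg + 2 * Real.pi, by linarith, by linarith, ?_⟩
      push_cast
      rw [add_mul, Complex.exp_add, h, Complex.exp_two_pi_mul_I, mul_one]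
  have hω (n : ℕ) : α = omega ^ n * Complex.exp ((θ - n * (2 * Real.pi / 3) : ℝ) * Complex.I) := by
    rw [hθ, omega, ← Complex.exp_nat_mul, ← Complex.exp_add]
    congr 1
    push_cast
    ring
  have hne (n : ℕ) : θ ≠ n * (2 * Real.pi / 3) := by
    intro h
    apply hα.2
    have h' := hω n
    rw [← h, sub_self] at h'
    rw [h']
    simpa using omega_pow_mem_Omega n
  have key (j : Fin 3) (hj₁ : ((j : ℕ) : ℝ) * (2 * Real.pi / 3) ≤ θ)
      (hj₂ : θ < ((j : ℕ) + 1 : ℝ) * (2 * Real.pi / 3)) : ∃ j : Fin 3, α ∈ arc j := by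
    refine ⟨j, _, ⟨_, ?_, ?_, rfl⟩, (hω j).symm⟩
    -- The left endpoint of the arc lies in Ω, hence is excluded.
    · exact sub_pos.2 (lt_of_le_of_ne hj₁ (hne j).symm)
    · linarith
  rcases lt_or_ge θ (2 * Real.pi / 3) with ha | ha
  · exact key 0 (by simpa using h0) (by simpa using ha)
  rcases lt_or_ge θ (2 * (2 * Real.pi / 3)) with hb | hb
  · exact key 1 (by simpa using ha) (by norm_num; linarith)
  · exact key 2 (by simpa using hb) (by norm_num; linarith)

lemma mem_arc_iff {α : ℂ} {j : Fin 3} : α ∈ arc j ↔ ∃ θ : ℝ, 0 < θ ∧ θ < 2 * Real.pi / 3 ∧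
    α = omega ^ (j : ℕ) * Complex.exp (θ * Complex.I) := by
  constructor
  · rintro ⟨_, ⟨θ, h0, h1, rfl⟩, rfl⟩
    exact ⟨θ, h0, h1, rfl⟩
  · rintro ⟨θ, h0, h1, rfl⟩
    exact ⟨_, ⟨θ, h0, h1, rfl⟩, rfl⟩

/-- Since ω⁻²ʲ = ωʲ, factoring out ωʲe^{-iθ/2} leaves e^{-3iθ/2} - e^{3iθ/2}. -/
lemma inv_sq_sub_self_omega_pow_mul_exp (j : ℕ) (θ : ℝ) :
    ((omega ^ j * Complex.exp (θ * Complex.I)) ^ 2)⁻¹ - omega ^ j * Complex.exp (θ * Complex.I) =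
      -2 * Complex.I * omega ^ j * (Real.sin (3 * θ / 2) : ℝ)
        * Complex.exp (-(θ / 2) * Complex.I) := by
  set e := Complex.exp (θ / 2 * Complex.I) with he
  have he0 : e ≠ 0 := Complex.exp_ne_zero _
  have h1 : Complex.exp (θ * Complex.I) = e ^ 2 := by
    rw [he, ← Complex.exp_nat_mul]; congr 1; push_cast; ring
  have h2 : Complex.exp (-(θ / 2) * Complex.I) = e⁻¹ := by
    rw [he, ← Complex.exp_neg]; congr 1; ring
  have h3 : ((Real.sin (3 * θ / 2) : ℝ) : ℂ) = ((e ^ 3)⁻¹ - e ^ 3) * Complex.I / 2 := by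
    have h : Complex.exp ((3 * θ / 2 : ℝ) * Complex.I) = e ^ 3 := by
      rw [he, ← Complex.exp_nat_mul]; congr 1; push_cast; ring
    rw [Complex.ofReal_sin, Complex.sin, neg_mul, Complex.exp_neg, h]
  have h4 : ((omega ^ j) ^ 2)⁻¹ = omega ^ j :=
    inv_sq_eq_self_of_pow_three_eq_one <| by
      rw [← pow_mul, mul_comm, pow_mul, omega_pow_three, one_pow]
  rw [h1, h2, h3, mul_pow, mul_inv, h4]
  field_simp
  linear_combination omega ^ j * (1 - e ^ 6) * Complex.I_sq

lemma sin_three_mul_div_two_pos {θ : ℝ} (h0 : 0 < θ) (h1 : θ < 2 * Real.pi / 3) :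
    0 < Real.sin (3 * θ / 2) :=
  Real.sin_pos_of_pos_of_lt_pi (by linarith) (by linarith)

lemma velocity_ne_zero {α₁ α₂ : ℂ} (h₁ : α₁ ∈ Parameter) (h₂ : α₂ ∈ Parameter) :
    velocity α₁ α₂ ≠ 0 := by
  have key {α : ℂ} (h : α ∈ Parameter) : (α ^ 2)⁻¹ - α ≠ 0 := by
    obtain ⟨j, hj⟩ := exists_mem_arc h
    obtain ⟨θ, h0, h1, rfl⟩ := mem_arc_iff.1 hj
    rw [inv_sq_sub_self_omega_pow_mul_exp]
    have := (sin_three_mul_div_two_pos h0 h1).ne'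
    simp only [ne_eq, mul_eq_zero, Complex.ofReal_eq_zero, this, Complex.exp_ne_zero,
      Complex.I_ne_zero, pow_eq_zero_iff', omega_ne_zero]
    norm_num
  exact mul_ne_zero (key h₁) (key h₂)

/-- The velocity is a real multiple of any inverse square root of `α₁ α₂`. -/
lemma exists_velocity_eq_real_mul {α₁ α₂ u : ℂ} (h₁ : α₁ ∈ Parameter) (h₂ : α₂ ∈ Parameter)
    (hu : ‖u‖ = 1) (hprod : (u ^ 2)⁻¹ = α₁ * α₂) :
    ∃ r : ℝ, r ≠ 0 ∧ velocity α₁ α₂ = r * u := by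
  have hn₁ := norm_eq_one_of_mem_Parameter h₁
  have hn₂ := norm_eq_one_of_mem_Parameter h₂
  have hu0 : u ≠ 0 := by rintro rfl; simp at hu
  have h₁0 : α₁ ≠ 0 := by rintro rfl; simp at hn₁
  have h₂0 : α₂ ≠ 0 := by rintro rfl; simp at hn₂
  have hconj : (starRingEnd ℂ) (velocity α₁ α₂ * u⁻¹) = velocity α₁ α₂ * u⁻¹ := by
    have hv : (starRingEnd ℂ) (velocity α₁ α₂) = α₁ * α₂ * velocity α₁ α₂ := by
      simp only [velocity, map_mul, map_sub, map_inv₀, map_pow,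
        ← inv_eq_conj_of_norm_eq_one hn₁, ← inv_eq_conj_of_norm_eq_one hn₂]
      field_simp
      ring
    rw [map_mul, hv, ← hprod, map_inv₀, ← inv_eq_conj_of_norm_eq_one hu, inv_inv]
    field_simp
  obtain ⟨r, hr⟩ := Complex.conj_eq_iff_real.1 hconj
  have hv : velocity α₁ α₂ = r * u := by rw [← hr]; field_simp
  refine ⟨r, ?_, hv⟩
  rintro rfl
  exact velocity_ne_zero h₁ h₂ (by simpa using hv)

lemma range_tau {α₁ α₂ u : ℂ} (h₁ : α₁ ∈ Parameter) (h₂ : α₂ ∈ Parameter)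
    (hu : ‖u‖ = 1) (hprod : (u ^ 2)⁻¹ = α₁ * α₂) :
    Set.range (tau α₁ α₂) = Set.range (fun t : ℝ => tau α₁ α₂ 1 + t • u) := by
  obtain ⟨r, hr, hv⟩ := exists_velocity_eq_real_mul h₁ h₂ hu hprod
  have ht := tau_eq (norm_eq_one_of_mem_Parameter h₁) (norm_eq_one_of_mem_Parameter h₂)
  ext z
  constructor
  · rintro ⟨t, rfl⟩
    refine ⟨(t - 1) * r, ?_⟩
    simp only [ht, hv, Complex.real_smul]
    push_cast
    ring
  · rintro ⟨t, rfl⟩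
    refine ⟨t / r + 1, ?_⟩
    have hrC : (r : ℂ) ≠ 0 := by exact_mod_cast hr
    simp only [ht, hv, Complex.real_smul]
    push_cast
    field_simp
    ring

lemma tau_one {α₁ α₂ : ℂ} (h₁ : ‖α₁‖ = 1) (h₂ : ‖α₂‖ = 1) :
    tau α₁ α₂ 1 = 2 * (α₁ * α₂) + ((α₁ * α₂) ^ 2)⁻¹ := by
  rw [tau_eq h₁ h₂]; simp

lemma isTangentLineAt_range_tau {α₁ α₂ : ℂ} (h₁ : α₁ ∈ Parameter) (h₂ : α₂ ∈ Parameter) :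
    IsTangentLineAt (Set.range (tau α₁ α₂)) deltoid (tau α₁ α₂ 1) := by
  have hn₁ := norm_eq_one_of_mem_Parameter h₁
  have hn₂ := norm_eq_one_of_mem_Parameter h₂
  obtain ⟨u, hu, hprod⟩ := exists_inv_sq_eq (γ := α₁ * α₂) (by simp [hn₁, hn₂])
  have hpt : tau α₁ α₂ 1 = deltoidPoint u := by
    rw [tau_one hn₁ hn₂, ← hprod, deltoidPoint, inv_pow, inv_inv]; ring
  refine ⟨hpt ▸ deltoidPoint_mem hu, u, ?_, range_tau h₁ h₂ hu hprod, ?_⟩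
  · rintro rfl; simp at hu
  · rw [hpt]; exact tangentConeAt_deltoid hu

/-! ### Comparing directions -/

lemma sameDirection_affine_iff {p v w : ℂ} (hw : w ≠ 0) :
    SameDirection (fun t => p + (t - 1 : ℝ) * v) (fun t => p + (t - 1 : ℝ) * w) ↔
      ∃ R : ℝ, 0 < R ∧ v = R * w := by
  constructor
  · rintro ⟨φ, hφ⟩
    have h1 := hφ 1
    have h2 := hφ 2
    simp only [add_right_inj] at h1 h2
    -- Both parametrizations pass through p at time 1 and w ≠ 0, so φ fixes 1; the ratio v/w is then
    -- φ 2 - 1.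
    have hφ1 : φ 1 = 1 := by
      have : ((φ 1 - 1 : ℝ) : ℂ) = 0 := by simpa [hw] using h1.symm
      exact sub_eq_zero.1 (by exact_mod_cast this)
    refine ⟨φ 2 - 1, ?_, ?_⟩
    · have : φ 1 < φ 2 := φ.strictMono (by norm_num)
      linarith
    · rw [← h2]; norm_num
  · rintro ⟨R, hR, rfl⟩
    refine ⟨(OrderIso.subRight (1 : ℝ)).trans ((OrderIso.mulRight₀ R hR).trans
      (OrderIso.addRight 1)), fun t => ?_⟩
    simp
    ring

lemma sameDirection_tau_iff {α₁ α₂ β₁ β₂ : ℂ} (hα₁ : α₁ ∈ Parameter) (hα₂ : α₂ ∈ Parameter)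
    (hβ₁ : β₁ ∈ Parameter) (hβ₂ : β₂ ∈ Parameter) (hprod : α₁ * α₂ = β₁ * β₂) :
    SameDirection (tau α₁ α₂) (tau β₁ β₂) ↔
      ∃ R : ℝ, 0 < R ∧ velocity α₁ α₂ = R * velocity β₁ β₂ := by
  have h1 : tau α₁ α₂ = fun t : ℝ => 2 * (β₁ * β₂) + ((β₁ * β₂) ^ 2)⁻¹
      + (t - 1 : ℝ) * velocity α₁ α₂ := by
    funext t
    rw [tau_eq (norm_eq_one_of_mem_Parameter hα₁) (norm_eq_one_of_mem_Parameter hα₂), hprod]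
  have h2 : tau β₁ β₂ = fun t : ℝ => 2 * (β₁ * β₂) + ((β₁ * β₂) ^ 2)⁻¹
      + (t - 1 : ℝ) * velocity β₁ β₂ :=
    funext (tau_eq (norm_eq_one_of_mem_Parameter hβ₁) (norm_eq_one_of_mem_Parameter hβ₂))
  rw [h1, h2]
  exact sameDirection_affine_iff (velocity_ne_zero hβ₁ hβ₂)

lemma velocity_mul_cubeRoot (α₁ α₂ : ℂ) {δ : ℂ} (hδ : δ ^ 3 = 1) :
    velocity (δ * α₁) (δ⁻¹ * α₂) = velocity α₁ α₂ := by
  have hδ0 : δ ≠ 0 := by rintro rfl; simp at hδ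
  have h1 : (δ ^ 2)⁻¹ = δ := inv_sq_eq_self_of_pow_three_eq_one hδ
  have h2 : (δ⁻¹ ^ 2)⁻¹ = δ⁻¹ := by rw [inv_pow, h1]
  simp only [velocity, mul_pow, mul_inv, h1, h2]
  field_simp

lemma velocity_omega_pow_mul_exp (j k : ℕ) (θ φ : ℝ) :
    velocity (omega ^ j * Complex.exp (θ * Complex.I)) (omega ^ k * Complex.exp (φ * Complex.I)) =
      (-4 * (Real.sin (3 * θ / 2) * Real.sin (3 * φ / 2)) : ℝ) *
        (omega ^ (j + k) * Complex.exp ((-(θ + φ) / 2 : ℝ) * Complex.I)) := by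
  have h : Complex.exp ((-(θ + φ) / 2 : ℝ) * Complex.I)
      = Complex.exp (-(θ / 2) * Complex.I) * Complex.exp (-(φ / 2) * Complex.I) := by
    rw [← Complex.exp_add]; congr 1; push_cast; ring
  rw [velocity, inv_sq_sub_self_omega_pow_mul_exp, inv_sq_sub_self_omega_pow_mul_exp, h, pow_add]
  push_cast
  linear_combination (4 * omega ^ j * omega ^ k * Complex.sin (3 * θ / 2) * Complex.sin (3 * φ / 2)
    * Complex.exp (-(θ / 2) * Complex.I) * Complex.exp (-(φ / 2) * Complex.I)) * Complex.I_sq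

lemma eq_of_exp_mul_I_eq {x y : ℝ} (h : Complex.exp (x * Complex.I) = Complex.exp (y * Complex.I))
    (hxy : |x - y| < 2 * Real.pi) : x = y := by
  obtain ⟨n, hn⟩ := Complex.exp_eq_exp_iff_exists_int.1 h
  have hn' : x = y + n * (2 * Real.pi) := by
    have : (x : ℂ) = ((y + n * (2 * Real.pi) : ℝ) : ℂ) := by
      apply mul_right_cancel₀ Complex.I_ne_zero
      rw [hn]; push_cast; ring
    exact_mod_cast this
  have hπ := Real.pi_pos
  have : |(n : ℝ)| < 1 := by
    rw [hn', add_sub_cancel_left, abs_mul, abs_of_pos (by positivity : 0 < 2 * Real.pi)] at hxy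
    nlinarith
  have hn0 : n = 0 := Int.abs_lt_one_iff.1 (by exact_mod_cast this)
  simpa [hn0] using hn'

/-- For equal products, the velocities are positively proportional exactly when a cube root of unity
moves the parameters into the same arcs. -/
lemma exists_pos_mul_velocity_iff {α₁ α₂ β₁ β₂ : ℂ} (hα₁ : α₁ ∈ Parameter)
    (hα₂ : α₂ ∈ Parameter) (hβ₁ : β₁ ∈ Parameter) (hβ₂ : β₂ ∈ Parameter)
    (hprod : α₁ * α₂ = β₁ * β₂) :
    (∃ R : ℝ, 0 < R ∧ velocity α₁ α₂ = R * velocity β₁ β₂) ↔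
      ∃ δ ∈ Omega, SameComponent (δ * α₁) β₁ ∧ SameComponent (δ⁻¹ * α₂) β₂ := by
  have hπ := Real.pi_pos
  have hω0 := omega_ne_zero
  constructor
  · rintro ⟨R, hR, hv⟩
    obtain ⟨j₁, hj₁⟩ := exists_mem_arc hα₁
    obtain ⟨j₂, hj₂⟩ := exists_mem_arc hα₂
    obtain ⟨k₁, hk₁⟩ := exists_mem_arc hβ₁
    obtain ⟨k₂, hk₂⟩ := exists_mem_arc hβ₂
    obtain ⟨θ₁, hθ₁, hθ₁', rfl⟩ := mem_arc_iff.1 hj₁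
    obtain ⟨θ₂, hθ₂, hθ₂', rfl⟩ := mem_arc_iff.1 hj₂
    obtain ⟨φ₁, hφ₁, hφ₁', rfl⟩ := mem_arc_iff.1 hk₁
    obtain ⟨φ₂, hφ₂, hφ₂', rfl⟩ := mem_arc_iff.1 hk₂
    have s1 := sin_three_mul_div_two_pos hθ₁ hθ₁'
    have s2 := sin_three_mul_div_two_pos hθ₂ hθ₂'
    have s3 := sin_three_mul_div_two_pos hφ₁ hφ₁'
    have s4 := sin_three_mul_div_two_pos hφ₂ hφ₂'
    rw [velocity_omega_pow_mul_exp, velocity_omega_pow_mul_exp] at hv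
    set A := Real.sin (3 * θ₁ / 2) * Real.sin (3 * θ₂ / 2) with hA
    set B := Real.sin (3 * φ₁ / 2) * Real.sin (3 * φ₂ / 2) with hB
    have hA0 : 0 < A := mul_pos s1 s2
    have hB0 : 0 < B := mul_pos s3 s4
    -- Taking norms separates the positive factors; the unit parts then agree in `hv'`.
    have hAB : A = R * B := by
      have h := congrArg norm hv
      simp only [norm_mul, norm_pow, norm_omega, one_pow, Complex.norm_exp_ofReal_mul_I,
        Complex.norm_real, mul_one, Real.norm_eq_abs, abs_of_pos hA0, abs_of_pos hB0,
        abs_of_pos hR] at h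
      norm_num at h
      linarith
    have hv' : omega ^ ((j₁ : ℕ) + j₂) * Complex.exp ((-(θ₁ + θ₂) / 2 : ℝ) * Complex.I)
        = omega ^ ((k₁ : ℕ) + k₂) * Complex.exp ((-(φ₁ + φ₂) / 2 : ℝ) * Complex.I) := by
      have hc : ((-4 * A : ℝ) : ℂ) ≠ 0 := by
        exact_mod_cast (by linarith : -4 * A < 0).ne
      apply mul_left_cancel₀ hc
      rw [hv, hAB]
      push_cast
      ring
    have hp : omega ^ ((j₁ : ℕ) + j₂) * Complex.exp ((θ₁ + θ₂ : ℝ) * Complex.I)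
        = omega ^ ((k₁ : ℕ) + k₂) * Complex.exp ((φ₁ + φ₂ : ℝ) * Complex.I) := by
      have e (x y : ℝ) : Complex.exp ((x + y : ℝ) * Complex.I)
          = Complex.exp (x * Complex.I) * Complex.exp (y * Complex.I) := by
        rw [← Complex.exp_add]; congr 1; push_cast; ring
      rw [e, e, pow_add, pow_add]
      linear_combination hprod
    have hsplit (x : ℝ) : Complex.exp ((x : ℝ) * Complex.I) =
        Complex.exp ((-x / 2 : ℝ) * Complex.I) * Complex.exp ((3 * x / 2 : ℝ) * Complex.I) := by
      rw [← Complex.exp_add]; congr 1; push_cast; ring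
    -- Dividing the equality of products by that of unit directions cancels the powers of ω. Both
    -- angles lie in (0, 2π), so they coincide.
    have hexp : Complex.exp ((3 * (θ₁ + θ₂) / 2 : ℝ) * Complex.I)
        = Complex.exp ((3 * (φ₁ + φ₂) / 2 : ℝ) * Complex.I) := by
      rw [hsplit (θ₁ + θ₂), hsplit (φ₁ + φ₂), ← mul_assoc, ← mul_assoc, hv'] at hp
      exact mul_left_cancel₀ (mul_ne_zero (pow_ne_zero _ hω0) (Complex.exp_ne_zero _)) hp
    have hang : θ₁ + θ₂ = φ₁ + φ₂ := by
      have := eq_of_exp_mul_I_eq hexp (abs_lt.2 ⟨by linarith, by linarith⟩)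
      linarith
    have hω : omega ^ ((j₁ : ℕ) + j₂) = omega ^ ((k₁ : ℕ) + k₂) := by
      rw [hang] at hp
      exact mul_right_cancel₀ (Complex.exp_ne_zero _) hp
    have hj3 : omega ^ (2 * (j₁ : ℕ)) * omega ^ (j₁ : ℕ) = 1 := by
      rw [← pow_add, show 2 * (j₁ : ℕ) + j₁ = 3 * j₁ by ring, pow_mul, omega_pow_three, one_pow]
    -- δ = ω^{k₁ - j₁}, with 2j₁ standing for -j₁ modulo 3.
    refine ⟨omega ^ ((k₁ : ℕ) + 2 * j₁), omega_pow_mem_Omega _,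
      ⟨k₁, mem_arc_iff.2 ⟨θ₁, hθ₁, hθ₁', ?_⟩, hk₁⟩, ⟨k₂, mem_arc_iff.2 ⟨θ₂, hθ₂, hθ₂', ?_⟩, hk₂⟩⟩
    · rw [pow_add]
      linear_combination omega ^ (k₁ : ℕ) * Complex.exp (θ₁ * Complex.I) * hj3
    · rw [inv_mul_eq_iff_eq_mul₀ (pow_ne_zero _ hω0), pow_add]
      rw [pow_add, pow_add] at hω
      linear_combination Complex.exp (θ₂ * Complex.I) * omega ^ (2 * (j₁ : ℕ)) * hω
        - Complex.exp (θ₂ * Complex.I) * omega ^ (j₂ : ℕ) * hj3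
  · rintro ⟨δ, hδ, ⟨j, hαj, hβj⟩, ⟨k, hαk, hβk⟩⟩
    have hδ3 := pow_three_of_mem_Omega hδ
    have hδ0 : δ ≠ 0 := by rintro rfl; simp at hδ3
    -- Replacing (α₁, α₂) by (δα₁, δ⁻¹α₂) changes neither velocity nor product, so the arcs may be
    -- taken equal.
    rw [← velocity_mul_cubeRoot α₁ α₂ hδ3]
    have hprod' : (δ * α₁) * (δ⁻¹ * α₂) = β₁ * β₂ := by rw [← hprod]; field_simp
    obtain ⟨θ₁, hθ₁, hθ₁', e1⟩ := mem_arc_iff.1 hαj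
    obtain ⟨θ₂, hθ₂, hθ₂', e2⟩ := mem_arc_iff.1 hαk
    obtain ⟨φ₁, hφ₁, hφ₁', rfl⟩ := mem_arc_iff.1 hβj
    obtain ⟨φ₂, hφ₂, hφ₂', rfl⟩ := mem_arc_iff.1 hβk
    have s1 := sin_three_mul_div_two_pos hθ₁ hθ₁'
    have s2 := sin_three_mul_div_two_pos hθ₂ hθ₂'
    have s3 := sin_three_mul_div_two_pos hφ₁ hφ₁'
    have s4 := sin_three_mul_div_two_pos hφ₂ hφ₂'
    rw [e1, e2] at hprod' ⊢
    have hang : θ₁ + θ₂ = φ₁ + φ₂ := by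
      -- Both sums lie in (0, 4π/3), so they differ by less than 2π.
      refine eq_of_exp_mul_I_eq ?_ (abs_lt.2 ⟨by linarith, by linarith⟩)
      push_cast
      rw [add_mul, add_mul, Complex.exp_add, Complex.exp_add]
      apply mul_left_cancel₀ (mul_ne_zero (pow_ne_zero (j : ℕ) hω0) (pow_ne_zero (k : ℕ) hω0))
      linear_combination hprod'
    rw [velocity_omega_pow_mul_exp, velocity_omega_pow_mul_exp, hang]
    refine ⟨_, div_pos (mul_pos s1 s2) (mul_pos s3 s4), ?_⟩
    conv_rhs => rw [← mul_assoc, ← Complex.ofReal_mul]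
    congr 2
    field_simp

end GoldmanDeltoid

theorem mainTheorem9 (α₁ α₂ β₁ β₂ : ℂ)
    (hα₁ : α₁ ∈ GoldmanDeltoid.Parameter) (hα₂ : α₂ ∈ GoldmanDeltoid.Parameter)
    (hβ₁ : β₁ ∈ GoldmanDeltoid.Parameter) (hβ₂ : β₂ ∈ GoldmanDeltoid.Parameter)
    (hprod : α₁ * α₂ = β₁ * β₂) :
    Set.range (GoldmanDeltoid.tau α₁ α₂) = Set.range (GoldmanDeltoid.tau β₁ β₂) ∧
    GoldmanDeltoid.tau α₁ α₂ 1 = GoldmanDeltoid.tau β₁ β₂ 1 ∧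
    GoldmanDeltoid.IsTangentLineAt (Set.range (GoldmanDeltoid.tau α₁ α₂))
      GoldmanDeltoid.deltoid (GoldmanDeltoid.tau α₁ α₂ 1) ∧
    (GoldmanDeltoid.SameDirection (GoldmanDeltoid.tau α₁ α₂) (GoldmanDeltoid.tau β₁ β₂) ↔
      ∃ δ ∈ GoldmanDeltoid.Omega, GoldmanDeltoid.SameComponent (δ * α₁) β₁ ∧
        GoldmanDeltoid.SameComponent (δ⁻¹ * α₂) β₂) := by
  have hnα₁ := GoldmanDeltoid.norm_eq_one_of_mem_Parameter hα₁
  have hnα₂ := GoldmanDeltoid.norm_eq_one_of_mem_Parameter hα₂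
  have hone : GoldmanDeltoid.tau α₁ α₂ 1 = GoldmanDeltoid.tau β₁ β₂ 1 := by
    rw [GoldmanDeltoid.tau_one hnα₁ hnα₂, hprod, GoldmanDeltoid.tau_one
      (GoldmanDeltoid.norm_eq_one_of_mem_Parameter hβ₁)
      (GoldmanDeltoid.norm_eq_one_of_mem_Parameter hβ₂)]
  refine ⟨?_, hone, GoldmanDeltoid.isTangentLineAt_range_tau hα₁ hα₂, ?_⟩
  · obtain ⟨u, hu, hu2⟩ := GoldmanDeltoid.exists_inv_sq_eq (γ := α₁ * α₂) (by simp [hnα₁, hnα₂])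
    rw [GoldmanDeltoid.range_tau hα₁ hα₂ hu hu2,
      GoldmanDeltoid.range_tau hβ₁ hβ₂ hu (hu2.trans hprod), hone]
  · exact (GoldmanDeltoid.sameDirection_tau_iff hα₁ hα₂ hβ₁ hβ₂ hprod).trans
      (GoldmanDeltoid.exists_pos_mul_velocity_iff hα₁ hα₂ hβ₁ hβ₂ hprod)
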